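/- **Proposition 1.1 (discrete Gagliardo–Nirenberg–Sobolev inequality).** Let $d\in\mathbb N$ and $p\in[1,\infty)$ with $p<d$ (so $d\ge 2$), and set $p^*=\frac{pd}{d-p}$. Let $Q=(0,1)^d$ and let $(e_i)_{1\le i\le d}$ be the canonical basis of $\mathbb R^d$. For $f\in L^1_{loc}(\mathbb R^d)$ (real-valued) define the discrete gradient $\delta f=(f(\cdot+e_i)-f)_{1\le i\le d}$ and the local average $\mathcal M(f)(z)=\int_{Q+z}f(x)\,dx$, $z\in\mathbb R^d$; put $$\mathbf A^p=\{f\in L^1_{loc}(\mathbb R^d):\ \delta f\in (L^p(\mathbb R^d))^d\},\qquad \mathcal E^p=\{f\in L^1_{loc}(\mathbb R^d):\ \mathcal M(|f|)\in L^{p^*}(\mathbb R^d)\},\qquad \|f\|_{\mathcal E^p}=\|\mathcal M(|f|)\|_{L^{p^*}(\mathbb R^d)}.$$ Then for every $f\in\mathbf A^p$ there exists a $\mathbb Z^d$-periodic function $f_{per}$, unique up to equality almost everywhere, such that $f-f_{per}\in\mathcal E^p$. Moreover there is a constant $C>0$, independent of $f$ (depending only on $d$ and $p$), such that for every $f\in\mathbf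 A^p$ $$\|f-f_{per}\|_{\mathcal E^p}\le C\,\|\delta f\|_{L^p(\mathbb R^d)},$$ where $\|\delta f\|_{L^p(\mathbb R^d)}$ is the $L^p$ norm of the Euclidean length of $\delta f$. -/

import Mathlib

open MeasureTheory
open scoped NNReal ENNReal

noncomputable section

namespace DiscreteGNS

/-- The discrete gradient `δ f = (f(· + e_i) - f)_{1 ≤ i ≤ d}`, with values in Euclidean `ℝ^d`. -/
def discreteGradient {d : ℕ} (f : EuclideanSpace ℝ (Fin d) → ℝ) :
    EuclideanSpace ℝ (Fin d) → EuclideanSpace ℝ (Fin d) :=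
  fun x => WithLp.toLp 2 fun i => f (x + EuclideanSpace.single i 1) - f x

/-- The translated open unit cube `Q + z = ∏_i ]z_i, z_i + 1[`. -/
def unitCube {d : ℕ} (z : EuclideanSpace ℝ (Fin d)) : Set (EuclideanSpace ℝ (Fin d)) :=
  {x | ∀ i, x i ∈ Set.Ioo (z i) (z i + 1)}

/-- The local average `M(f)(z) = ∫_{Q + z} f(x) dx`. -/
def localAverage {d : ℕ} (f : EuclideanSpace ℝ (Fin d) → ℝ) :
    EuclideanSpace ℝ (Fin d) → ℝ :=
  fun z => ∫ x in unitCube z, f x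

/-- The Sobolev exponent `p^* = p d / (d - p)` (used for `1 ≤ p < d`). -/
def sobolevExponent (d : ℕ) (p : ℝ) : ℝ := p * d / (d - p)

/-- The space of locally integrable functions whose discrete gradient is in `L^p`. -/
structure MemDiscreteSobolev {d : ℕ} (p : ℝ) (f : EuclideanSpace ℝ (Fin d) → ℝ) : Prop where
  locallyIntegrable : LocallyIntegrable f volume
  memLp_discreteGradient : MemLp (discreteGradient f) (ENNReal.ofReal p) volume

/-- The space `E^p` of locally integrable functions `f` with `M(|f|) ∈ L^{p^*}`. -/
structure MemE {d : ℕ} (p : ℝ) (f : EuclideanSpace ℝ (Fin d) → ℝ) : Prop where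
  locallyIntegrable : LocallyIntegrable f volume
  memLp_localAverage :
    MemLp (localAverage fun x => |f x|) (ENNReal.ofReal (sobolevExponent d p)) volume

/-- The norm `‖f‖_{E^p} = ‖M(|f|)‖_{L^{p^*}}`, as an extended nonnegative real
(it is finite when `f` is in `E^p`). -/
def normE {d : ℕ} (p : ℝ) (f : EuclideanSpace ℝ (Fin d) → ℝ) : ℝ≥0∞ :=
  eLpNorm (localAverage fun x => |f x|) (ENNReal.ofReal (sobolevExponent d p)) volume

/-- The vector of `ℝ^d` with integer coordinates `k`. -/
def latticeVector {d : ℕ} (k : Fin d → ℤ) : EuclideanSpace ℝ (Fin d) :=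
  WithLp.toLp 2 fun i => (k i : ℝ)

/-- `ℤ^d`-periodicity at every point. -/
def IsPeriodic {d : ℕ} (f : EuclideanSpace ℝ (Fin d) → ℝ) : Prop :=
  ∀ k : Fin d → ℤ, ∀ x, f (x + latticeVector k) = f x

/-- `ℤ^d`-periodicity of the almost-everywhere class of a function. -/
def IsAEPeriodic {d : ℕ} (f : EuclideanSpace ℝ (Fin d) → ℝ) : Prop :=
  ∀ k : Fin d → ℤ, ∀ᵐ x, f (x + latticeVector k) = f x

end DiscreteGNS

end

/-! Restricted to the translates of a point `x` by ℤ^d, `f` becomes a lattice function `fiber f x`,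
and integrating over `x` in a unit cube a sum over the lattice gives back an integral over ℝ^d.
Hence the ℓ^p energy of the fibers is integrable over the cube and almost every fiber has finite
energy. By the Sobolev inequality on ℤ^d, such a fiber is a constant plus an ℓ^{p*} function. The
constant is the limit of the fiber at infinity; it depends only on `x` modulo ℤ^d, and it is the
value of f_per at `x` (`latticeLimit`).

The lattice inequality is `exists_tsum_sub_rpow_le_latticeEnergy`. For finite support, the case p =
1 is the product inequality over grid lines, and general p follows by applying it to |u|^γ. For
arbitrary u of finite energy, u - c_N is multiplied by a tent of radius N: a Poincaré inequality on
the box bounds the cost of the cut-off uniformly in N, and compactness of the constants c_N allows N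
→ ∞.

Minkowski's inequality (`tsum_lintegral_rpow_le`) turns the resulting L^1(ℓ^{p*}) bound on each cube
into the bound on M(|f - f_per|). For uniqueness, the modulus of the difference of two candidates is
periodic, so its local average is constant; this constant is dominated by an L^{p*} function on a
space of infinite measure, so it vanishes. -/

noncomputable section

namespace DiscreteGNS

/-! ### Sobolev inequality on ℤ^d for finitely supported functions. -/

/-- The forward difference of a function on `ℤ^d` in the `i`-th direction. -/
def latticeDiff {d : ℕ} (u : (Fin d → ℤ) → ℝ) (i : Fin d) (k : Fin d → ℤ) : ℝ :=
  u (k + Pi.single i 1) - u k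

/-- The `p`-energy `∑_k ∑_i |u(k + e_i) - u(k)|^p` of a function on `ℤ^d`. -/
def latticeEnergy {d : ℕ} (p : ℝ) (u : (Fin d → ℤ) → ℝ) : ℝ≥0∞ :=
  ∑' k, ∑ i, ‖latticeDiff u i k‖ₑ ^ p

/-- Telescoping. The closed interval also contains the increment from `b` to `b + 1`, which is
superfluous but makes the bound independent of `m` and `n`. -/
lemma enorm_sub_le_sum_diff (v : ℤ → ℝ) {a b m n : ℤ} (hm : m ∈ Finset.Icc a b)
    (hn : n ∈ Finset.Icc a b) :
    ‖v n - v m‖ₑ ≤ ∑ j ∈ Finset.Icc a b, ‖v (j + 1) - v j‖ₑ := by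
  have key : ∀ m n : ℤ, m ≤ n → ‖v n - v m‖ₑ ≤ ∑ j ∈ Finset.Ico m n, ‖v (j + 1) - v j‖ₑ := by
    intro m n hmn
    induction n, hmn using Int.leInduction with
    | base => simp
    | succ n hmn ih =>
      have h : Finset.Ico m (n + 1) = insert n (Finset.Ico m n) := by
        ext x; simp only [Finset.mem_Ico, Finset.mem_insert]; omega
      rw [h, Finset.sum_insert (by simp)]
      calc ‖v (n + 1) - v m‖ₑ = ‖(v (n + 1) - v n) + (v n - v m)‖ₑ := by congr 1; ring
        _ ≤ _ := (enorm_add_le _ _).trans (by gcongr)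
  rw [Finset.mem_Icc] at hm hn
  rcases le_total m n with h | h
  · refine (key m n h).trans (Finset.sum_le_sum_of_subset ?_)
    intro x; simp only [Finset.mem_Ico, Finset.mem_Icc]; omega
  · rw [enorm_sub_rev]
    refine (key n m h).trans (Finset.sum_le_sum_of_subset ?_)
    intro x; simp only [Finset.mem_Ico, Finset.mem_Icc]; omega

lemma enorm_le_tsum_diff (v : ℤ → ℝ) (hv : v.support.Finite) (n : ℤ) :
    ‖v n‖ₑ ≤ ∑' j, ‖v (j + 1) - v j‖ₑ := by
  obtain ⟨m, hm⟩ := hv.exists_notMem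
  have hm0 : v m = 0 := by simpa using hm
  calc ‖v n‖ₑ = ‖v n - v m‖ₑ := by simp [hm0]
    _ ≤ ∑ j ∈ Finset.Icc (min m n) (max m n), ‖v (j + 1) - v j‖ₑ :=
      enorm_sub_le_sum_diff v (by simp) (by simp)
    _ ≤ _ := ENNReal.sum_le_tsum _

lemma pi_count_int (d : ℕ) :
    Measure.pi (fun _ : Fin d => (Measure.count : Measure ℤ)) = Measure.count := by
  refine Measure.ext_of_singleton fun a => ?_
  simp [Measure.pi_singleton]

lemma latticeDiff_update {d : ℕ} (u : (Fin d → ℤ) → ℝ) (i : Fin d) (k : Fin d → ℤ) (j : ℤ) :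
    latticeDiff u i (Function.update k i j) =
      u (Function.update k i (j + 1)) - u (Function.update k i j) := by
  unfold latticeDiff
  congr 2
  ext l
  by_cases h : l = i
  · subst h; simp
  · simp [h]

/-- The discrete Gagliardo–Nirenberg inequality for `p = 1`. -/
lemma tsum_rpow_le_tsum_diff_rpow {d : ℕ} (hd : 2 ≤ d) (u : (Fin d → ℤ) → ℝ)
    (hu : u.support.Finite) :
    ∑' k, ‖u k‖ₑ ^ ((d : ℝ) / (d - 1)) ≤
      (∑' k, ∑ i, ‖latticeDiff u i k‖ₑ) ^ ((d : ℝ) / (d - 1)) := by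
  have hd' : (2 : ℝ) ≤ d := by exact_mod_cast hd
  have hconj : Real.HolderConjugate (Fintype.card (Fin d)) ((d : ℝ) / (d - 1)) := by
    rw [Fintype.card_fin, Real.holderConjugate_iff]
    refine ⟨by linarith, ?_⟩
    have : (d : ℝ) - 1 ≠ 0 := by linarith
    field_simp
    ring
  -- The grid-lines inequality: the product over `i` of the line sums in direction `i`, each to the
  -- power 1/(d - 1), sums to at most the d/(d - 1) power of the full sum.
  have := lintegral_prod_lintegral_pow_le (fun _ : Fin d => (Measure.count : Measure ℤ)) hconj
    (f := fun k => ∑ i, ‖latticeDiff u i k‖ₑ) (measurable_of_countable _)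
  rw [pi_count_int, lintegral_count, lintegral_count] at this
  simp only [lintegral_count, Fintype.card_fin] at this
  refine le_trans (ENNReal.tsum_le_tsum fun k => ?_) this
  have h1 : ‖u k‖ₑ ^ ((d : ℝ) / (d - 1)) = ∏ _i : Fin d, ‖u k‖ₑ ^ ((1 : ℝ) / (d - 1)) := by
    rw [Finset.prod_const, Finset.card_univ, Fintype.card_fin, ← ENNReal.rpow_natCast,
      ← ENNReal.rpow_mul]
    congr 1; ring
  rw [h1]
  refine Finset.prod_le_prod' fun i _ => ?_
  refine ENNReal.rpow_le_rpow ?_ (by apply div_nonneg <;> linarith)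
  have h2 := enorm_le_tsum_diff (fun j => u (Function.update k i j))
    (hu.preimage ((Function.update_injective k i).injOn)) (k i)
  rw [Function.update_eq_self] at h2
  refine h2.trans (ENNReal.tsum_le_tsum fun j => ?_)
  rw [← latticeDiff_update]
  exact Finset.single_le_sum (f := fun i' => ‖latticeDiff u i' (Function.update k i j)‖ₑ)
    (fun _ _ => zero_le) (Finset.mem_univ i)

/-- A substitute for the chain rule. For `b ≤ a`, Bernoulli's inequality at `b / a - 1` says that
the graph of the power lies above its tangent at `a`. -/
lemma abs_rpow_sub_rpow_le {a b γ : ℝ} (ha : 0 ≤ a) (hb : 0 ≤ b) (hγ : 1 ≤ γ) :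
    |a ^ γ - b ^ γ| ≤ γ * (a ^ (γ - 1) + b ^ (γ - 1)) * |a - b| := by
  wlog hab : b ≤ a generalizing a b
  · have := this hb ha (le_of_not_ge hab)
    rwa [abs_sub_comm, add_comm, abs_sub_comm b a] at this
  rcases ha.eq_or_lt with rfl | ha
  · have : b = 0 := le_antisymm hab hb
    subst this; simp
  have hmono : b ^ γ ≤ a ^ γ := Real.rpow_le_rpow hb hab (by linarith)
  rw [abs_of_nonneg (by linarith), abs_of_nonneg (by linarith)]
  have h1 := one_add_mul_self_le_rpow_one_add (s := b / a - 1) (by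
    have := div_nonneg hb ha.le; linarith) hγ
  have h2 : (1 + (b / a - 1)) ^ γ = b ^ γ / a ^ γ := by
    rw [add_sub_cancel, Real.div_rpow hb ha.le]
  rw [h2, le_div_iff₀ (Real.rpow_pos_of_pos ha γ)] at h1
  have h3 : a ^ γ = a ^ (γ - 1) * a := by
    rw [Real.rpow_sub_one ha.ne']; field_simp
  have h4 : (1 + γ * (b / a - 1)) * a ^ γ = a ^ γ + γ * a ^ (γ - 1) * (b - a) := by
    rw [h3]; field_simp
  have h5 : 0 ≤ γ * b ^ (γ - 1) * (a - b) :=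
    mul_nonneg (mul_nonneg (by linarith) (Real.rpow_nonneg hb _)) (by linarith)
  nlinarith

lemma enorm_abs_rpow_sub_le (a b : ℝ) {γ : ℝ} (hγ : 1 ≤ γ) :
    ‖|a| ^ γ - |b| ^ γ‖ₑ ≤
      ENNReal.ofReal γ * (‖a‖ₑ ^ (γ - 1) + ‖b‖ₑ ^ (γ - 1)) * ‖a - b‖ₑ := by
  have h0 : 0 ≤ γ - 1 := by linarith
  have h := abs_rpow_sub_rpow_le (abs_nonneg a) (abs_nonneg b) hγ
  have ha : ‖a‖ₑ ^ (γ - 1) = ENNReal.ofReal (|a| ^ (γ - 1)) := by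
    rw [← ENNReal.ofReal_rpow_of_nonneg (abs_nonneg a) h0, Real.enorm_eq_ofReal_abs]
  have hb : ‖b‖ₑ ^ (γ - 1) = ENNReal.ofReal (|b| ^ (γ - 1)) := by
    rw [← ENNReal.ofReal_rpow_of_nonneg (abs_nonneg b) h0, Real.enorm_eq_ofReal_abs]
  rw [ha, hb, Real.enorm_eq_ofReal_abs, Real.enorm_eq_ofReal_abs,
    ← ENNReal.ofReal_add (by positivity) (by positivity),
    ← ENNReal.ofReal_mul (by linarith), ← ENNReal.ofReal_mul (by positivity)]
  refine ENNReal.ofReal_le_ofReal (h.trans ?_)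
  exact mul_le_mul_of_nonneg_left (abs_abs_sub_abs_le_abs_sub a b) (by positivity)

lemma tsum_mul_rpow_le {ι : Type*} (f g : ι → ℝ≥0∞) {s t : ℝ} (hs : 0 ≤ s) (ht : 0 ≤ t)
    (hst : s + t = 1) : ∑' k, f k ^ s * g k ^ t ≤ (∑' k, f k) ^ s * (∑' k, g k) ^ t := by
  let _ : MeasurableSpace ι := ⊤
  have h := ENNReal.lintegral_mul_norm_pow_le (μ := (Measure.count : Measure ι)) (f := f) (g := g)
    (Measurable.aemeasurable (measurable_from_top)) (Measurable.aemeasurable (measurable_from_top))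
    hs ht hst
  simpa only [lintegral_count] using h

/-- The discrete Gagliardo–Nirenberg–Sobolev inequality for finitely supported functions. -/
lemma tsum_rpow_le_latticeEnergy {d : ℕ} {p : ℝ} (hp : 1 ≤ p) (hpd : p < d)
    (u : (Fin d → ℤ) → ℝ) (hu : u.support.Finite) :
    (∑' k, ‖u k‖ₑ ^ sobolevExponent d p) ^ (1 / sobolevExponent d p) ≤
      (d * (2 * ENNReal.ofReal (p * (d - 1) / (d - p)))) * latticeEnergy p u ^ (1 / p) := by
  -- This γ makes γ d/(d - 1) = q and (γ - 1) p' = q simultaneously, so the same sum `S` appears on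
  -- both sides and can be absorbed.
  set γ : ℝ := p * (d - 1) / (d - p) with hγdef
  set q : ℝ := sobolevExponent d p with hqdef
  set S := ∑' k, ‖u k‖ₑ ^ q with hS
  have hdp : 0 < (d : ℝ) - p := by linarith
  have hp0 : 0 < p := by linarith
  have hd1 : (1 : ℝ) < d := by linarith
  have hd2 : 2 ≤ d := by exact_mod_cast (show 1 < d by exact_mod_cast hd1)
  have hd10 : (0 : ℝ) < d - 1 := by linarith
  have hd0 : (0 : ℝ) < d := by linarith
  have hq : q = p * d / (d - p) := rfl
  have hq0 : 0 < q := by rw [hq]; positivity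
  have hγ1 : 1 ≤ γ := by
    rw [hγdef, le_div_iff₀ hdp]; nlinarith
  have hγd : γ * (d / (d - 1)) = q := by rw [hγdef, hq]; field_simp
  have hγp : q * (1 - 1 / p) = γ - 1 := by rw [hγdef, hq]; field_simp; ring
  have hw := tsum_rpow_le_tsum_diff_rpow hd2 (fun k => |u k| ^ γ) (hu.subset (by
    intro k hk
    simp only [Function.mem_support] at hk ⊢
    rintro h0
    apply hk
    rw [h0, abs_zero, Real.zero_rpow (by linarith)]))
  have hlhs : ∑' k, ‖|u k| ^ γ‖ₑ ^ ((d : ℝ) / (d - 1)) = S := by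
    refine tsum_congr fun k => ?_
    rw [Real.enorm_rpow_of_nonneg (abs_nonneg _) (by linarith), Real.enorm_abs, ← ENNReal.rpow_mul,
      hγd]
  rw [hlhs] at hw
  have hSfin : S ≠ ∞ := by
    rw [hS, tsum_eq_sum (s := hu.toFinset)]
    · exact (ENNReal.sum_lt_top.2 fun k _ =>
        ENNReal.rpow_lt_top_of_nonneg hq0.le enorm_ne_top).ne
    · intro k hk
      have : u k = 0 := by simpa using hk
      simp [this, hq0]
  rcases eq_or_ne S 0 with hS0 | hS0
  · rw [hS0, ENNReal.zero_rpow_of_pos (by positivity)]; exact zero_le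
  -- The shift `e` covers both endpoints of an edge: `e = 0` and `e` the unit vector in direction
  -- `i`.
  have hhold : ∀ i, ∀ e : Fin d → ℤ, ∑' k, ‖u (k + e)‖ₑ ^ (γ - 1) * ‖latticeDiff u i k‖ₑ ≤
      S ^ (1 - 1 / p) * latticeEnergy p u ^ (1 / p) := by
    intro i e
    have h1 : 1 / p ≤ 1 := by rw [div_le_one hp0]; exact hp
    have h := tsum_mul_rpow_le (fun k => ‖u (k + e)‖ₑ ^ q) (fun k => ‖latticeDiff u i k‖ₑ ^ p)
      (s := 1 - 1 / p) (t := 1 / p) (by linarith) (by positivity) (by ring)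
    simp only [← ENNReal.rpow_mul, hγp, mul_one_div_cancel hp0.ne', ENNReal.rpow_one] at h
    refine h.trans ?_
    have hshift : ∑' k, ‖u (k + e)‖ₑ ^ q = S := (Equiv.addRight e).tsum_eq (fun k => ‖u k‖ₑ ^ q)
    rw [hshift]
    gcongr
    exact ENNReal.tsum_le_tsum fun k => Finset.single_le_sum
      (f := fun i' => ‖latticeDiff u i' k‖ₑ ^ p) (fun _ _ => zero_le) (Finset.mem_univ i)
  have hsum : ∑' k, ∑ i, ‖latticeDiff (fun k => |u k| ^ γ) i k‖ₑ ≤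
      d * (2 * ENNReal.ofReal γ) * (S ^ (1 - 1 / p) * latticeEnergy p u ^ (1 / p)) := by
    rw [Summable.tsum_finsetSum (fun _ _ => ENNReal.summable)]
    have : ∀ i : Fin d, ∑' k, ‖latticeDiff (fun k => |u k| ^ γ) i k‖ₑ ≤
        2 * ENNReal.ofReal γ * (S ^ (1 - 1 / p) * latticeEnergy p u ^ (1 / p)) := by
      intro i
      calc _ ≤ ∑' k, ENNReal.ofReal γ *
            (‖u (k + Pi.single i 1)‖ₑ ^ (γ - 1) * ‖latticeDiff u i k‖ₑ +
              ‖u (k + 0)‖ₑ ^ (γ - 1) * ‖latticeDiff u i k‖ₑ) := by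
            refine ENNReal.tsum_le_tsum fun k => ?_
            refine (enorm_abs_rpow_sub_le _ _ hγ1).trans_eq ?_
            rw [add_zero, latticeDiff]; ring
        _ ≤ ENNReal.ofReal γ * (S ^ (1 - 1 / p) * latticeEnergy p u ^ (1 / p) +
              S ^ (1 - 1 / p) * latticeEnergy p u ^ (1 / p)) := by
            rw [ENNReal.tsum_mul_left, ENNReal.tsum_add]
            gcongr <;> exact hhold i _
        _ = _ := by ring
    refine (Finset.sum_le_sum fun i _ => this i).trans_eq ?_
    simp; ring
  have h1 : S ^ (((d : ℝ) - 1) / d) ≤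
      d * (2 * ENNReal.ofReal γ) * (S ^ (1 - 1 / p) * latticeEnergy p u ^ (1 / p)) := by
    refine le_trans (ENNReal.rpow_le_rpow hw (by positivity)) ?_
    rw [← ENNReal.rpow_mul, show (d : ℝ) / (d - 1) * ((d - 1) / d) = 1 by field_simp,
      ENNReal.rpow_one]
    exact hsum
  -- Dividing by `S ^ (1 - 1 / p)`, which is neither 0 nor ∞, leaves exactly the power 1/q.
  have hexp : ((d : ℝ) - 1) / d = (1 - 1 / p) + 1 / q := by
    rw [hq]; field_simp; ring
  rw [hexp, ENNReal.rpow_add _ _ hS0 hSfin] at h1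
  have hne : S ^ (1 - 1 / p) ≠ 0 := by simp [ENNReal.rpow_eq_zero_iff, hS0, hSfin]
  have hne' : S ^ (1 - 1 / p) ≠ ∞ := by simp [ENNReal.rpow_eq_top_iff, hS0, hSfin]
  rw [← ENNReal.mul_le_mul_iff_right hne hne']
  refine h1.trans_eq ?_
  ring

/-! ### Poincaré inequality on lattice boxes. -/

/-- The box `I^d` in `ℤ^d`. -/
def latticeBox (d : ℕ) (I : Finset ℤ) : Finset (Fin d → ℤ) := Fintype.piFinset fun _ => I

lemma mem_latticeBox {d : ℕ} {I : Finset ℤ} {k : Fin d → ℤ} :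
    k ∈ latticeBox d I ↔ ∀ i, k i ∈ I := Fintype.mem_piFinset

lemma update_mem_latticeBox {d : ℕ} {I : Finset ℤ} {k : Fin d → ℤ} (hk : k ∈ latticeBox d I)
    (i : Fin d) {j : ℤ} (hj : j ∈ I) : Function.update k i j ∈ latticeBox d I := by
  rw [mem_latticeBox] at hk ⊢
  intro l
  by_cases h : l = i
  · subst h; simpa
  · simpa [h] using hk l

lemma piecewise_mem_latticeBox {d : ℕ} {I : Finset ℤ} {k l : Fin d → ℤ} (hk : k ∈ latticeBox d I)
    (hl : l ∈ latticeBox d I) (s : Finset (Fin d)) : s.piecewise k l ∈ latticeBox d I := by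
  rw [mem_latticeBox] at hk hl ⊢
  intro i
  by_cases h : i ∈ s <;> simp [h, hk i, hl i]

/-- The map exchanging `m i` with `j` is an involution of the box times `I`. -/
lemma sum_latticeBox_line {d : ℕ} (I : Finset ℤ) (i : Fin d) (g : (Fin d → ℤ) → ℝ≥0∞) :
    ∑ m ∈ latticeBox d I, ∑ j ∈ I, g (Function.update m i j) =
      (I.card : ℝ≥0∞) * ∑ m ∈ latticeBox d I, g m := by
  have h : ∑ m ∈ latticeBox d I, ∑ j ∈ I, g (Function.update m i j) =
      ∑ m ∈ latticeBox d I, ∑ _j ∈ I, g m := by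
    rw [← Finset.sum_product', ← Finset.sum_product']
    refine Finset.sum_bij' (fun x _ => (Function.update x.1 i x.2, x.1 i))
      (fun x _ => (Function.update x.1 i x.2, x.1 i)) ?_ ?_ ?_ ?_ ?_
    · rintro ⟨m, j⟩ hx
      rw [Finset.mem_product] at hx ⊢
      exact ⟨update_mem_latticeBox hx.1 i hx.2, mem_latticeBox.1 hx.1 i⟩
    · rintro ⟨m, j⟩ hx
      rw [Finset.mem_product] at hx ⊢
      exact ⟨update_mem_latticeBox hx.1 i hx.2, mem_latticeBox.1 hx.1 i⟩
    · rintro ⟨m, j⟩ _; simp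
    · rintro ⟨m, j⟩ _; simp
    · rintro ⟨m, j⟩ _; simp
  rw [h, Finset.sum_comm]
  simp

/-- Exchanging the coordinates in `s` between `k` and `l` is an involution on pairs of points of the
box. -/
lemma sum_latticeBox_piecewise_swap {d : ℕ} (I : Finset ℤ) (s : Finset (Fin d))
    (F : (Fin d → ℤ) → (Fin d → ℤ) → ℝ≥0∞) :
    ∑ k ∈ latticeBox d I, ∑ l ∈ latticeBox d I, F (s.piecewise l k) (s.piecewise k l) =
      ∑ k ∈ latticeBox d I, ∑ l ∈ latticeBox d I, F k l := by
  rw [← Finset.sum_product', ← Finset.sum_product']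
  have hinv : ∀ k l : Fin d → ℤ, s.piecewise (s.piecewise k l) (s.piecewise l k) = k := by
    intro k l; ext i; by_cases h : i ∈ s <;> simp [h]
  refine Finset.sum_bij' (fun x _ => (s.piecewise x.2 x.1, s.piecewise x.1 x.2))
    (fun x _ => (s.piecewise x.2 x.1, s.piecewise x.1 x.2)) ?_ ?_ ?_ ?_ ?_
  · rintro ⟨k, l⟩ hx
    rw [Finset.mem_product] at hx ⊢
    exact ⟨piecewise_mem_latticeBox hx.2 hx.1 s, piecewise_mem_latticeBox hx.1 hx.2 s⟩
  · rintro ⟨k, l⟩ hx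
    rw [Finset.mem_product] at hx ⊢
    exact ⟨piecewise_mem_latticeBox hx.2 hx.1 s, piecewise_mem_latticeBox hx.1 hx.2 s⟩
  · rintro ⟨k, l⟩ _; simp [hinv]
  · rintro ⟨k, l⟩ _; simp [hinv]
  · rintro ⟨k, l⟩ _; rfl

/-- Telescoping along the line and convexity of the power cost `I.card ^ (p - 1)`; each point of the
box lies on the lines of `I.card` points, which supplies the last factor. -/
lemma sum_latticeBox_update_le {d : ℕ} {p : ℝ} (hp : 1 ≤ p) (a b : ℤ) (u : (Fin d → ℤ) → ℝ)
    (i : Fin d) :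
    ∑ m ∈ latticeBox d (Finset.Icc a b), ∑ l ∈ latticeBox d (Finset.Icc a b),
        ‖u m - u (Function.update m i (l i))‖ₑ ^ p ≤
      (latticeBox d (Finset.Icc a b)).card *
        (((Finset.Icc a b).card : ℝ≥0∞) ^ p * latticeEnergy p u) := by
  set I := Finset.Icc a b with hI
  have hp0 : 0 ≤ p := by linarith
  have hpt : ∀ m ∈ latticeBox d I, ∀ l ∈ latticeBox d I,
      ‖u m - u (Function.update m i (l i))‖ₑ ^ p ≤
        (I.card : ℝ≥0∞) ^ (p - 1) * ∑ j ∈ I, ‖latticeDiff u i (Function.update m i j)‖ₑ ^ p := by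
    intro m hm l hl
    refine le_trans ?_ (ENNReal.rpow_sum_le_const_mul_sum_rpow I _ hp)
    refine ENNReal.rpow_le_rpow ?_ hp0
    have h := enorm_sub_le_sum_diff (fun j => u (Function.update m i j))
      (mem_latticeBox.1 hl i) (mem_latticeBox.1 hm i)
    rw [Function.update_eq_self] at h
    simpa only [latticeDiff_update] using h
  calc _ ≤ ∑ m ∈ latticeBox d I, ∑ _l ∈ latticeBox d I, (I.card : ℝ≥0∞) ^ (p - 1) *
          ∑ j ∈ I, ‖latticeDiff u i (Function.update m i j)‖ₑ ^ p :=
        Finset.sum_le_sum fun m hm => Finset.sum_le_sum fun l hl => hpt m hm l hl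
    _ = (latticeBox d I).card * ((I.card : ℝ≥0∞) ^ (p - 1) * (I.card *
          ∑ m ∈ latticeBox d I, ‖latticeDiff u i m‖ₑ ^ p)) := by
        rw [← sum_latticeBox_line I i (fun m => ‖latticeDiff u i m‖ₑ ^ p), Finset.mul_sum,
          Finset.mul_sum]
        simp
    _ ≤ (latticeBox d I).card * ((I.card : ℝ≥0∞) ^ (p - 1) * (I.card * latticeEnergy p u)) := by
        gcongr
        refine le_trans (Finset.sum_le_sum fun m _ => ?_) (ENNReal.sum_le_tsum _)
        exact Finset.single_le_sum (f := fun i' => ‖latticeDiff u i' m‖ₑ ^ p)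
          (fun _ _ => zero_le) (Finset.mem_univ i)
    _ = _ := by
        rw [← mul_assoc ((I.card : ℝ≥0∞) ^ (p - 1))]
        congr 2
        have := ENNReal.rpow_add_of_nonneg (x := (I.card : ℝ≥0∞)) (p - 1) 1 (by linarith)
          zero_le_one
        rw [ENNReal.rpow_one, sub_add_cancel] at this
        exact this.symm

/-- The coordinates of `k` are replaced by those of `l` one at a time. After the swap of coordinates
in `s`, each increment becomes a change of one coordinate, summed over all pairs of the box. -/
lemma exists_sum_latticeBox_piecewise_le {d : ℕ} {p : ℝ} (hp : 1 ≤ p) (s : Finset (Fin d)) :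
    ∃ C : ℝ≥0, ∀ (a b : ℤ) (u : (Fin d → ℤ) → ℝ),
      ∑ k ∈ latticeBox d (Finset.Icc a b), ∑ l ∈ latticeBox d (Finset.Icc a b),
          ‖u k - u (s.piecewise l k)‖ₑ ^ p ≤
        C * ((latticeBox d (Finset.Icc a b)).card *
          (((Finset.Icc a b).card : ℝ≥0∞) ^ p * latticeEnergy p u)) := by
  have hp0 : 0 < p := by linarith
  induction s using Finset.induction_on with
  | empty => exact ⟨0, fun a b u => by simp [hp0]⟩
  | insert i s his ih =>
    obtain ⟨C, hC⟩ := ih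
    refine ⟨2 ^ (p - 1) * (C + 1), fun a b u => ?_⟩
    set B := latticeBox d (Finset.Icc a b)
    set X := (B.card : ℝ≥0∞) * (((Finset.Icc a b).card : ℝ≥0∞) ^ p * latticeEnergy p u)
    have h1 : ∑ k ∈ B, ∑ l ∈ B,
        ‖u (s.piecewise l k) - u ((insert i s).piecewise l k)‖ₑ ^ p ≤ X := by
      have h := sum_latticeBox_piecewise_swap (Finset.Icc a b) s
        (fun m m' => ‖u m - u (Function.update m i (m' i))‖ₑ ^ p)
      refine le_trans (le_of_eq ?_) (sum_latticeBox_update_le hp a b u i)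
      rw [← h]
      refine Finset.sum_congr rfl fun k _ => Finset.sum_congr rfl fun l _ => ?_
      rw [Finset.piecewise_insert, Finset.piecewise_eq_of_notMem _ _ _ his]
    calc _ ≤ ∑ k ∈ B, ∑ l ∈ B, (2 : ℝ≥0∞) ^ (p - 1) * (‖u k - u (s.piecewise l k)‖ₑ ^ p +
            ‖u (s.piecewise l k) - u ((insert i s).piecewise l k)‖ₑ ^ p) := by
          refine Finset.sum_le_sum fun k _ => Finset.sum_le_sum fun l _ => ?_
          refine le_trans ?_ (ENNReal.rpow_add_le_mul_rpow_add_rpow _ _ hp)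
          refine ENNReal.rpow_le_rpow ?_ hp0.le
          rw [← sub_add_sub_cancel (u k) (u (s.piecewise l k))]
          exact enorm_add_le _ _
      _ ≤ 2 ^ (p - 1) * (C * X + X) := by
          simp only [← Finset.mul_sum, Finset.sum_add_distrib]
          gcongr
          exact hC a b u
      _ = _ := by
          rw [ENNReal.coe_mul, ENNReal.coe_add, ENNReal.coe_rpow_of_nonneg _ (by linarith)]
          simp only [ENNReal.coe_one, ENNReal.coe_ofNat]
          ring

/-- A Poincaré inequality on boxes of `ℤ^d`. -/
lemma exists_sum_latticeBox_sub_le (d : ℕ) {p : ℝ} (hp : 1 ≤ p) :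
    ∃ C : ℝ≥0, ∀ (a b : ℤ) (u : (Fin d → ℤ) → ℝ), a ≤ b → ∃ c : ℝ,
      ∑ k ∈ latticeBox d (Finset.Icc a b), ‖u k - c‖ₑ ^ p ≤
        C * (((Finset.Icc a b).card : ℝ≥0∞) ^ p * latticeEnergy p u) := by
  obtain ⟨C, hC⟩ := exists_sum_latticeBox_piecewise_le (d := d) hp Finset.univ
  refine ⟨C, fun a b u hab => ?_⟩
  have h := hC a b u
  simp only [Finset.piecewise_univ] at h
  rw [Finset.sum_comm] at h
  have hne : (latticeBox d (Finset.Icc a b)).Nonempty :=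
    ⟨fun _ => a, mem_latticeBox.2 fun _ => by simp [hab]⟩
  -- Some `l` does no worse than the average over the box, and `u l` serves as the constant.
  obtain ⟨l, _, hl⟩ := ENNReal.exists_le_of_sum_le hne (h.trans_eq (c :=
    ∑ _l ∈ latticeBox d (Finset.Icc a b),
      C * (((Finset.Icc a b).card : ℝ≥0∞) ^ p * latticeEnergy p u)) (by
        simp only [Finset.sum_const, nsmul_eq_mul]; ring))
  exact ⟨u l, hl⟩

/-! ### Cut-off by tents and removal of the finite support. -/

/-- The tent function on `ℤ^d` with support in the ball of radius `N`. -/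
def latticeTent {d : ℕ} (N : ℕ) (k : Fin d → ℤ) : ℝ := max (1 - ‖k‖ / N) 0

lemma latticeTent_zero {d : ℕ} (N : ℕ) : latticeTent N (0 : Fin d → ℤ) = 1 := by
  simp [latticeTent]

lemma enorm_latticeTent_le {d : ℕ} (N : ℕ) (k : Fin d → ℤ) : ‖latticeTent N k‖ₑ ≤ 1 := by
  have h0 : 0 ≤ latticeTent N k := le_max_right _ _
  have h1 : latticeTent N k ≤ 1 :=
    max_le (by have : 0 ≤ ‖k‖ / N := by positivity
               linarith) zero_le_one
  rw [Real.enorm_eq_ofReal h0]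
  exact ENNReal.ofReal_le_one.2 h1

lemma enorm_latticeTent_sub_le {d : ℕ} {N : ℕ} (hN : 0 < N) (k : Fin d → ℤ) (i : Fin d) :
    ‖latticeTent N (k + Pi.single i 1) - latticeTent N k‖ₑ ≤ (N : ℝ≥0∞)⁻¹ := by
  have hN' : (0 : ℝ) < N := by exact_mod_cast hN
  have h : |latticeTent N (k + Pi.single i 1) - latticeTent N k| ≤ (N : ℝ)⁻¹ := by
    refine (abs_max_sub_max_le_abs _ _ _).trans ?_
    rw [show 1 - ‖k + Pi.single i 1‖ / N - (1 - ‖k‖ / N) =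
      (‖k‖ - ‖k + Pi.single i (1 : ℤ)‖) / N by ring, abs_div, abs_of_pos hN', div_eq_mul_inv]
    refine mul_le_of_le_one_left (by positivity) ?_
    refine (abs_norm_sub_norm_le _ _).trans ?_
    rw [sub_add_cancel_left, norm_neg, Pi.norm_single]
    simp
  rw [Real.enorm_eq_ofReal_abs]
  refine (ENNReal.ofReal_le_ofReal h).trans_eq ?_
  rw [ENNReal.ofReal_inv_of_pos hN', ENNReal.ofReal_natCast]

lemma latticeTent_eq_zero {d : ℕ} {N : ℕ} (hN : 0 < N) {k : Fin d → ℤ} (hk : N ≤ ‖k‖) :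
    latticeTent N k = 0 := by
  have hN' : (0 : ℝ) < N := by exact_mod_cast hN
  refine max_eq_right ?_
  rw [sub_nonpos, le_div_iff₀ hN']
  linarith

/-- Integrality gains the extra 1, so the neighbours of a point outside the box are also outside the
support of the tent. -/
lemma natCast_add_one_le_norm {d : ℕ} {N : ℕ} {k : Fin d → ℤ}
    (hk : k ∉ latticeBox d (Finset.Icc (-(N : ℤ)) N)) : (N : ℝ) + 1 ≤ ‖k‖ := by
  rw [mem_latticeBox] at hk
  push Not at hk
  obtain ⟨i, hi⟩ := hk
  refine le_trans ?_ (norm_le_pi_norm k i)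
  rw [Finset.mem_Icc, ← abs_le] at hi
  rw [Int.norm_eq_abs]
  exact_mod_cast not_le.1 hi

lemma support_latticeTent_mul {d : ℕ} {N : ℕ} (hN : 0 < N) (v : (Fin d → ℤ) → ℝ) :
    (Function.support fun k => latticeTent N k * v k).Finite := by
  refine (latticeBox d (Finset.Icc (-(N : ℤ)) N)).finite_toSet.subset fun k hk => ?_
  by_contra hk'
  refine hk ?_
  have := natCast_add_one_le_norm hk'
  simp only [latticeTent_eq_zero hN (by linarith : (N : ℝ) ≤ ‖k‖), zero_mul]

/-- Discrete Leibniz rule: the tent is at most 1 and is 1/N-Lipschitz, and edges based outside the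
box do not contribute. -/
lemma latticeEnergy_latticeTent_mul_le {d : ℕ} {p : ℝ} (hp : 1 ≤ p) {N : ℕ} (hN : 0 < N)
    (u : (Fin d → ℤ) → ℝ) (c : ℝ) :
    latticeEnergy p (fun k => latticeTent N k * (u k - c)) ≤
      2 ^ (p - 1) * (latticeEnergy p u + d * ((N : ℝ≥0∞)⁻¹ ^ p *
        ∑ k ∈ latticeBox d (Finset.Icc (-(N : ℤ)) N), ‖u k - c‖ₑ ^ p)) := by
  classical
  have hp0 : 0 < p := by linarith
  set B := latticeBox d (Finset.Icc (-(N : ℤ)) N) with hB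
  have hpt : ∀ (k : Fin d → ℤ) (i : Fin d),
      ‖latticeDiff (fun k => latticeTent N k * (u k - c)) i k‖ₑ ^ p ≤
        2 ^ (p - 1) * (‖latticeDiff u i k‖ₑ ^ p +
          (N : ℝ≥0∞)⁻¹ ^ p * if k ∈ B then ‖u k - c‖ₑ ^ p else 0) := by
    intro k i
    by_cases hk : k ∈ B
    · rw [if_pos hk, ← ENNReal.mul_rpow_of_nonneg _ _ hp0.le]
      refine le_trans ?_ (ENNReal.rpow_add_le_mul_rpow_add_rpow _ _ hp)
      refine ENNReal.rpow_le_rpow ?_ hp0.le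
      have : latticeDiff (fun k => latticeTent N k * (u k - c)) i k =
          latticeTent N (k + Pi.single i 1) * latticeDiff u i k +
            (latticeTent N (k + Pi.single i 1) - latticeTent N k) * (u k - c) := by
        simp only [latticeDiff]; ring
      rw [this]
      refine (enorm_add_le _ _).trans ?_
      rw [enorm_mul, enorm_mul]
      gcongr
      · exact mul_le_of_le_one_left zero_le (enorm_latticeTent_le _ _)
      · exact enorm_latticeTent_sub_le hN k i
    · have h1 := natCast_add_one_le_norm hk
      have h2 : (N : ℝ) ≤ ‖k + Pi.single i (1 : ℤ)‖ := by
        have h3 := norm_sub_le (k + Pi.single i (1 : ℤ)) (Pi.single i (1 : ℤ))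
        rw [add_sub_cancel_right, Pi.norm_single, norm_one] at h3
        linarith
      have : latticeDiff (fun k => latticeTent N k * (u k - c)) i k = 0 := by
        simp only [latticeDiff, latticeTent_eq_zero hN h2,
          latticeTent_eq_zero hN (by linarith : (N : ℝ) ≤ ‖k‖), zero_mul, sub_zero]
      rw [this, enorm_zero, ENNReal.zero_rpow_of_pos hp0]
      exact zero_le
  have hsum : ∑' k, (if k ∈ B then ‖u k - c‖ₑ ^ p else 0) = ∑ k ∈ B, ‖u k - c‖ₑ ^ p := by
    rw [tsum_eq_sum (s := B) (fun k hk => if_neg hk)]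
    exact Finset.sum_congr rfl fun k hk => if_pos hk
  refine (ENNReal.tsum_le_tsum fun k => Finset.sum_le_sum fun i _ => hpt k i).trans_eq ?_
  simp only [← Finset.mul_sum, Finset.sum_add_distrib, ENNReal.tsum_mul_left, ENNReal.tsum_add,
    Finset.sum_const, Finset.card_univ, Fintype.card_fin, nsmul_eq_mul, hsum, latticeEnergy]
  ring

/-- Scale invariance: the Poincaré factor (2N + 1)^p is compensated by the tent slope N^{-p}, since
2N + 1 ≤ 3N. The constant is thus independent of `N`. -/
lemma exists_latticeEnergy_latticeTent_mul_le (d : ℕ) {p : ℝ} (hp : 1 ≤ p) :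
    ∃ C : ℝ≥0, ∀ (u : (Fin d → ℤ) → ℝ) (N : ℕ), 0 < N → ∃ c : ℝ,
      latticeEnergy p (fun k => latticeTent N k * (u k - c)) ≤ C * latticeEnergy p u := by
  obtain ⟨C, hC⟩ := exists_sum_latticeBox_sub_le d hp
  refine ⟨2 ^ (p - 1) * (1 + d * (C * 3 ^ p)), fun u N hN => ?_⟩
  obtain ⟨c, hc⟩ := hC (-(N : ℤ)) N u (by omega)
  refine ⟨c, (latticeEnergy_latticeTent_mul_le hp hN u c).trans ?_⟩
  have hcard : (N : ℝ≥0∞)⁻¹ ^ p * ((Finset.Icc (-(N : ℤ)) N).card : ℝ≥0∞) ^ p ≤ 3 ^ p := by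
    rw [← ENNReal.mul_rpow_of_nonneg _ _ (by linarith)]
    refine ENNReal.rpow_le_rpow ?_ (by linarith)
    rw [mul_comm, ← div_eq_mul_inv]
    refine ENNReal.div_le_of_le_mul ?_
    rw [Int.card_Icc]
    norm_cast
    omega
  calc _ ≤ 2 ^ (p - 1) * (latticeEnergy p u + d * ((N : ℝ≥0∞)⁻¹ ^ p *
          (C * (((Finset.Icc (-(N : ℤ)) N).card : ℝ≥0∞) ^ p * latticeEnergy p u)))) := by
        gcongr
    _ = 2 ^ (p - 1) * (latticeEnergy p u + d * (C * (((N : ℝ≥0∞)⁻¹ ^ p *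
          ((Finset.Icc (-(N : ℤ)) N).card : ℝ≥0∞) ^ p) * latticeEnergy p u))) := by ring
    _ ≤ 2 ^ (p - 1) * (latticeEnergy p u + d * (C * (3 ^ p * latticeEnergy p u))) := by gcongr
    _ = _ := by
        push_cast
        rw [ENNReal.coe_rpow_of_nonneg _ (by linarith), ENNReal.coe_rpow_of_nonneg _ (by linarith)]
        push_cast
        ring

lemma tendsto_latticeTent {d : ℕ} (k : Fin d → ℤ) :
    Filter.Tendsto (fun N : ℕ => latticeTent N k) Filter.atTop (nhds 1) := by
  have h : Filter.Tendsto (fun N : ℕ => max (1 - ‖k‖ / (N : ℝ)) 0) Filter.atTop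
      (nhds (max (1 - 0) 0)) :=
    (tendsto_const_nhds.sub (tendsto_const_div_atTop_nhds_zero_nat ‖k‖)).max tendsto_const_nhds
  rwa [sub_zero, max_eq_left zero_le_one] at h

/-- The discrete Gagliardo–Nirenberg–Sobolev inequality on `ℤ^d`, up to an additive constant. -/
theorem exists_tsum_sub_rpow_le_latticeEnergy {d : ℕ} {p : ℝ} (hp : 1 ≤ p) (hpd : p < d) :
    ∃ C : ℝ≥0, ∀ u : (Fin d → ℤ) → ℝ, latticeEnergy p u ≠ ∞ → ∃ c : ℝ,
      (∑' k, ‖u k - c‖ₑ ^ sobolevExponent d p) ^ (1 / sobolevExponent d p) ≤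
        C * latticeEnergy p u ^ (1 / p) := by
  have hp0 : 0 < p := by linarith
  have hdp : 0 < (d : ℝ) - p := by linarith
  have hq0 : 0 < sobolevExponent d p := by
    have : (0 : ℝ) < d := by linarith
    unfold sobolevExponent; positivity
  set q := sobolevExponent d p
  obtain ⟨C, hC⟩ := exists_latticeEnergy_latticeTent_mul_le d hp
  refine ⟨(d * (2 * Real.toNNReal (p * (d - 1) / (d - p)))) * C ^ (1 / p), fun u hu => ?_⟩
  set R : ℝ≥0∞ := ((d * (2 * Real.toNNReal (p * (d - 1) / (d - p)))) * C ^ (1 / p) : ℝ≥0) *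
    latticeEnergy p u ^ (1 / p) with hR
  have hRfin : R ≠ ∞ := ENNReal.mul_ne_top ENNReal.coe_ne_top
    (ENNReal.rpow_ne_top_of_nonneg (by positivity) hu)
  choose c hc using fun N : ℕ => hC u (N + 1) N.succ_pos
  have hbound : ∀ N, ∑' k, ‖latticeTent (N + 1) k * (u k - c N)‖ₑ ^ q ≤ R ^ q := by
    intro N
    have h := tsum_rpow_le_latticeEnergy hp hpd _
      (support_latticeTent_mul N.succ_pos (fun k => u k - c N))
    rw [← ENNReal.rpow_inv_le_iff hq0, ← one_div]
    refine h.trans ?_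
    calc _ ≤ (d * (2 * ENNReal.ofReal (p * (d - 1) / (d - p)))) *
          (C * latticeEnergy p u) ^ (1 / p) := by gcongr; exact hc N
      _ = R := by
        rw [hR, ENNReal.mul_rpow_of_nonneg _ _ (by positivity)]
        push_cast
        rw [← ENNReal.coe_rpow_of_nonneg _ (by positivity)]
        rw [ENNReal.ofReal]
        ring
  -- The single term at the origin, where the tent equals 1, already confines `c N`.
  have hcball : ∀ N, c N ∈ Metric.closedBall (u 0) R.toReal := by
    intro N
    have h := (ENNReal.le_tsum 0).trans (hbound N)
    rw [latticeTent_zero, one_mul, ENNReal.rpow_le_rpow_iff hq0] at h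
    rw [mem_closedBall_iff_norm', ← toReal_enorm]
    exact ENNReal.toReal_mono hRfin h
  obtain ⟨c₀, -, φ, hφ, hlim⟩ := (isCompact_closedBall (u 0) R.toReal).tendsto_subseq hcball
  refine ⟨c₀, ?_⟩
  rw [one_div, ENNReal.rpow_inv_le_iff hq0, ENNReal.tsum_eq_iSup_sum]
  -- On a finite set `A` the limit can be taken term by term.
  refine iSup_le fun A => ?_
  have htend : Filter.Tendsto
      (fun n => ∑ k ∈ A, ‖latticeTent (φ n + 1) k * (u k - c (φ n))‖ₑ ^ q) Filter.atTop
      (nhds (∑ k ∈ A, ‖u k - c₀‖ₑ ^ q)) := by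
    refine tendsto_finsetSum _ fun k _ => ?_
    refine ((ENNReal.continuous_rpow_const (y := q)).tendsto _).comp ?_
    refine (continuous_enorm.tendsto _).comp ?_
    have h1 : Filter.Tendsto (fun n => latticeTent (φ n + 1) k) Filter.atTop (nhds 1) :=
      (tendsto_latticeTent k).comp ((Filter.tendsto_add_atTop_nat 1).comp hφ.tendsto_atTop)
    simpa using h1.mul (tendsto_const_nhds.sub hlim)
  exact le_of_tendsto' htend fun n => (ENNReal.sum_le_tsum A).trans (hbound (φ n))

/-! ### Unit cubes, unfolding of integrals and local averages. -/

section Cubes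

variable {d : ℕ}

@[simp] lemma latticeVector_apply (k : Fin d → ℤ) (i : Fin d) : latticeVector k i = (k i : ℝ) := rfl

lemma latticeVector_neg (k : Fin d → ℤ) : latticeVector (-k) = -latticeVector k := by
  ext i; simp

lemma latticeVector_add (k l : Fin d → ℤ) :
    latticeVector (k + l) = latticeVector k + latticeVector l := by
  ext i; simp

lemma latticeVector_single (i : Fin d) :
    latticeVector (Pi.single i 1) = EuclideanSpace.single i (1 : ℝ) := by
  ext j
  by_cases h : j = i
  · subst h; simp
  · simp [h]

/-- The translated half-open unit cube `∏_i [z_i, z_i + 1)`. -/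
def halfOpenCube (z : EuclideanSpace ℝ (Fin d)) : Set (EuclideanSpace ℝ (Fin d)) :=
  {x | ∀ i, x i ∈ Set.Ico (z i) (z i + 1)}

lemma measurableSet_halfOpenCube (z : EuclideanSpace ℝ (Fin d)) :
    MeasurableSet (halfOpenCube z) := by
  simp only [halfOpenCube, Set.ofPred_forall]
  exact MeasurableSet.iInter fun i => measurableSet_Ico.preimage (by fun_prop)

lemma isOpen_unitCube (z : EuclideanSpace ℝ (Fin d)) : IsOpen (unitCube z) := by
  simp only [unitCube, Set.ofPred_forall]
  exact isOpen_iInter_of_finite fun i => isOpen_Ioo.preimage (by fun_prop)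

lemma unitCube_ae_eq_halfOpenCube (z : EuclideanSpace ℝ (Fin d)) :
    unitCube z =ᵐ[volume] halfOpenCube z := by
  have h : (Set.univ.pi fun i => Set.Ioo (z i) (z i + 1)) =ᵐ[(volume : Measure (Fin d → ℝ))]
      (Set.univ.pi fun i => Set.Ico (z i) (z i + 1)) :=
    Measure.univ_pi_Ioo_ae_eq_Icc.trans Measure.univ_pi_Ico_ae_eq_Icc.symm
  have h' := (EuclideanSpace.volume_preserving_symm_measurableEquiv_toLp
    (Fin d)).quasiMeasurePreserving.preimage_ae_eq h
  have h1 : unitCube z = (MeasurableEquiv.toLp 2 (Fin d → ℝ)).symm ⁻¹'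
      Set.univ.pi fun i => Set.Ioo (z i) (z i + 1) := by
    ext x; simp [unitCube]
  have h2 : halfOpenCube z = (MeasurableEquiv.toLp 2 (Fin d → ℝ)).symm ⁻¹'
      Set.univ.pi fun i => Set.Ico (z i) (z i + 1) := by
    ext x; simp [halfOpenCube]
  rwa [← h1, ← h2] at h'

lemma volume_unitCube (z : EuclideanSpace ℝ (Fin d)) : volume (unitCube z) = 1 := by
  have h := (EuclideanSpace.volume_preserving_symm_measurableEquiv_toLp
    (Fin d)).measure_preimage (s := Set.univ.pi fun i => Set.Ioo (z i) (z i + 1))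
    (MeasurableSet.univ_pi fun _ => measurableSet_Ioo).nullMeasurableSet
  rw [Real.volume_pi_Ioo] at h
  simp only [add_sub_cancel_left, ENNReal.ofReal_one, Finset.prod_const_one] at h
  rw [← h]
  congr 1
  ext x; simp [unitCube]

/-- Half-open cubes tile space exactly, which makes the sum of indicators equal to 1 at every point
and not only almost everywhere. -/
lemma exists_latticeVector_add_mem (w x : EuclideanSpace ℝ (Fin d)) :
    ∃ k : Fin d → ℤ, x + latticeVector k ∈ halfOpenCube w ∧
      ∀ l : Fin d → ℤ, x + latticeVector l ∈ halfOpenCube w → l = k := by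
  refine ⟨fun i => -⌊x i - w i⌋, fun i => ?_, fun l hl => funext fun i => ?_⟩
  · have h1 := Int.floor_le (x i - w i)
    have h2 := Int.lt_floor_add_one (x i - w i)
    simp only [PiLp.add_apply, latticeVector_apply, Int.cast_neg, Set.mem_Ico]
    constructor <;> linarith
  · have h := hl i
    simp only [PiLp.add_apply, latticeVector_apply, Set.mem_Ico] at h
    have : ⌊x i - w i⌋ = -l i := by
      rw [Int.floor_eq_iff]
      push_cast
      constructor <;> linarith
    omega

lemma tsum_indicator_halfOpenCube (w x : EuclideanSpace ℝ (Fin d)) (a : ℝ≥0∞) :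
    ∑' k : Fin d → ℤ, (halfOpenCube w).indicator (fun _ => a) (x + latticeVector k) = a := by
  obtain ⟨k, hk, huniq⟩ := exists_latticeVector_add_mem w x
  rw [tsum_eq_single k fun l hl => Set.indicator_of_notMem (fun h => hl (huniq l h)) _,
    Set.indicator_of_mem hk]

lemma quasiMeasurePreserving_add_const (v : EuclideanSpace ℝ (Fin d)) :
    Measure.QuasiMeasurePreserving (fun x : EuclideanSpace ℝ (Fin d) => x + v) volume volume :=
  (measurePreserving_add_right volume v).quasiMeasurePreserving

lemma setLIntegral_unitCube_eq (z : EuclideanSpace ℝ (Fin d))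
    (F : EuclideanSpace ℝ (Fin d) → ℝ≥0∞) :
    ∫⁻ x in unitCube z, F x = ∫⁻ x in halfOpenCube z, F x :=
  setLIntegral_congr (unitCube_ae_eq_halfOpenCube z)

/-- The integral over `ℝ^d` as the integral over a unit cube of the sum over the lattice. -/
lemma lintegral_eq_setLIntegral_unitCube_tsum (z : EuclideanSpace ℝ (Fin d))
    {F : EuclideanSpace ℝ (Fin d) → ℝ≥0∞} (hF : AEMeasurable F volume) :
    ∫⁻ x, F x = ∫⁻ x in unitCube z, ∑' k : Fin d → ℤ, F (x + latticeVector k) := by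
  have hshift : ∀ k : Fin d → ℤ, AEMeasurable (fun x => F (x + latticeVector k)) volume :=
    fun k => hF.comp_quasiMeasurePreserving (quasiMeasurePreserving_add_const _)
  rw [setLIntegral_unitCube_eq, lintegral_tsum fun k => (hshift k).restrict]
  calc ∫⁻ x, F x = ∫⁻ x, ∑' k : Fin d → ℤ,
        (halfOpenCube z).indicator (fun _ => F x) (x + latticeVector k) := by
        simp only [tsum_indicator_halfOpenCube]
    _ = ∑' k : Fin d → ℤ, ∫⁻ x,
        (halfOpenCube z).indicator (fun _ => F x) (x + latticeVector k) := by
        refine lintegral_tsum fun k => ?_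
        exact hF.indicator ((measurableSet_halfOpenCube z).preimage
          (measurable_add_const (latticeVector k)))
    _ = ∑' k : Fin d → ℤ, ∫⁻ x in halfOpenCube z, F (x + latticeVector (-k)) := by
        refine tsum_congr fun k => ?_
        rw [← lintegral_indicator (measurableSet_halfOpenCube z)]
        refine Eq.trans ?_ (lintegral_add_right_eq_self _ (latticeVector k))
        refine lintegral_congr fun x => ?_
        simp only [Set.indicator, latticeVector_neg, add_neg_cancel_right]
    _ = _ := (Equiv.neg (Fin d → ℤ)).tsum_eq
        (fun k => ∫⁻ x in halfOpenCube z, F (x + latticeVector k))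

lemma setLIntegral_unitCube_add (z v : EuclideanSpace ℝ (Fin d))
    (F : EuclideanSpace ℝ (Fin d) → ℝ≥0∞) :
    ∫⁻ x in unitCube (z + v), F x = ∫⁻ x in unitCube z, F (x + v) := by
  rw [← lintegral_indicator (isOpen_unitCube _).measurableSet,
    ← lintegral_indicator (isOpen_unitCube _).measurableSet]
  refine (lintegral_add_right_eq_self _ v).symm.trans ?_
  refine lintegral_congr fun x => ?_
  have : x + v ∈ unitCube (z + v) ↔ x ∈ unitCube z := by
    refine forall_congr' fun i => ?_
    simp only [PiLp.add_apply, Set.mem_Ioo]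
    constructor <;> rintro ⟨h1, h2⟩ <;> constructor <;> linarith
  by_cases hx : x ∈ unitCube z
  · rw [Set.indicator_of_mem hx, Set.indicator_of_mem (this.2 hx)]
  · rw [Set.indicator_of_notMem hx, Set.indicator_of_notMem fun h => hx (this.1 h)]

/-- A periodic function has the same integral over all unit cubes. -/
lemma setLIntegral_unitCube_eq_of_periodic {F : EuclideanSpace ℝ (Fin d) → ℝ≥0∞}
    (hF : AEMeasurable F volume) (hper : ∀ k : Fin d → ℤ, ∀ᵐ x, F (x + latticeVector k) = F x)
    (z w : EuclideanSpace ℝ (Fin d)) :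
    ∫⁻ x in unitCube z, F x = ∫⁻ x in unitCube w, F x := by
  -- Unfolding over the cube at `z` the function `F` cut off to the cube at `w`: periodicity pulls
  -- `F x` out of the lattice sum, and exactly one indicator survives.
  rw [setLIntegral_unitCube_eq w, ← lintegral_indicator (measurableSet_halfOpenCube w),
    lintegral_eq_setLIntegral_unitCube_tsum z (hF.indicator (measurableSet_halfOpenCube w))]
  refine lintegral_congr_ae (ae_restrict_of_ae ?_)
  filter_upwards [ae_all_iff.2 hper] with x hx
  rw [← tsum_indicator_halfOpenCube w x (F x)]
  refine tsum_congr fun k => ?_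
  simp only [Set.indicator, hx k]

lemma ae_of_ae_restrict_unitCube {P : EuclideanSpace ℝ (Fin d) → Prop}
    (h : ∀ z, ∀ᵐ x ∂(volume.restrict (unitCube z)), P x) : ∀ᵐ x, P x := by
  have hU : ⋃ k : Fin d → ℤ, halfOpenCube (latticeVector k) = Set.univ := by
    refine Set.eq_univ_of_forall fun x => ?_
    obtain ⟨k, hk, -⟩ := exists_latticeVector_add_mem 0 x
    refine Set.mem_iUnion.2 ⟨-k, fun i => ?_⟩
    have := hk i
    simp only [PiLp.add_apply, latticeVector_apply, Set.mem_Ico, PiLp.zero_apply] at this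
    simp only [latticeVector_apply, Pi.neg_apply, Int.cast_neg, Set.mem_Ico]
    constructor <;> linarith
  rw [← Measure.restrict_univ (μ := volume), ← hU, ae_restrict_iUnion_iff]
  intro k
  rw [← Measure.restrict_congr_set (unitCube_ae_eq_halfOpenCube _)]
  exact h _

lemma integrableOn_unitCube {h : EuclideanSpace ℝ (Fin d) → ℝ}
    (hh : LocallyIntegrable h volume) (z : EuclideanSpace ℝ (Fin d)) :
    IntegrableOn h (unitCube z) volume := by
  have hK : IsCompact (WithLp.toLp 2 '' Set.Icc (fun i => z i) (fun i => z i + 1) :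
      Set (EuclideanSpace ℝ (Fin d))) :=
    isCompact_Icc.image (PiLp.continuous_toLp 2 _)
  refine (hh.integrableOn_isCompact hK).mono_set fun x hx => ?_
  exact ⟨fun i => x i, ⟨fun i => (hx i).1.le, fun i => (hx i).2.le⟩, rfl⟩

lemma locallyIntegrable_of_unitCube {h : EuclideanSpace ℝ (Fin d) → ℝ}
    (hh : ∀ z, IntegrableOn h (unitCube z) volume) : LocallyIntegrable h volume := by
  intro x
  refine ⟨unitCube (x - WithLp.toLp 2 fun _ => 1 / 2), (isOpen_unitCube _).mem_nhds fun i => ?_,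
    hh _⟩
  simp only [PiLp.sub_apply, Set.mem_Ioo]
  constructor <;> linarith

lemma enorm_localAverage_abs {h : EuclideanSpace ℝ (Fin d) → ℝ} {z : EuclideanSpace ℝ (Fin d)}
    (hh : IntegrableOn h (unitCube z) volume) :
    ‖localAverage (fun x => |h x|) z‖ₑ = ∫⁻ x in unitCube z, ‖h x‖ₑ := by
  have h0 : 0 ≤ localAverage (fun x => |h x|) z := integral_nonneg fun x => abs_nonneg (h x)
  rw [Real.enorm_eq_ofReal h0, ← ofReal_integral_norm_eq_lintegral_enorm hh]
  rfl

lemma aestronglyMeasurable_localAverage {h : EuclideanSpace ℝ (Fin d) → ℝ}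
    (hh : AEStronglyMeasurable h volume) : AEStronglyMeasurable (localAverage h) volume := by
  have hS : MeasurableSet {y : EuclideanSpace ℝ (Fin d) × EuclideanSpace ℝ (Fin d) |
      y.2 ∈ unitCube y.1} := by
    have h1 : ∀ i, MeasurableSet {y : EuclideanSpace ℝ (Fin d) × EuclideanSpace ℝ (Fin d) |
        y.1 i < y.2 i} := fun i => measurableSet_lt (by fun_prop) (by fun_prop)
    have h2 : ∀ i, MeasurableSet {y : EuclideanSpace ℝ (Fin d) × EuclideanSpace ℝ (Fin d) |
        y.2 i < y.1 i + 1} := fun i => measurableSet_lt (by fun_prop) (by fun_prop)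
    convert! MeasurableSet.iInter fun i => (h1 i).inter (h2 i) using 1
    ext y
    simp [unitCube]
  have hprod : AEStronglyMeasurable
      (fun y : EuclideanSpace ℝ (Fin d) × EuclideanSpace ℝ (Fin d) => h y.2)
      (volume.prod volume) := hh.comp_quasiMeasurePreserving Measure.quasiMeasurePreserving_snd
  have := (hprod.indicator hS).integral_prod_right'
  refine this.congr (Filter.Eventually.of_forall fun z => ?_)
  simp only [localAverage]
  rw [← integral_indicator (isOpen_unitCube z).measurableSet]
  rfl

end Cubes

/-! ### Minkowski's inequality for sums of integrals. -/

/-- Minkowski's integral inequality for `ℓ^q`-valued functions. -/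
lemma tsum_lintegral_rpow_le {α ι : Type*} [MeasurableSpace α] {μ : Measure α}
    {q : ℝ} (hq : 1 ≤ q) {g : ι → α → ℝ≥0∞} (hg : ∀ i, AEMeasurable (g i) μ) :
    ∑' i, (∫⁻ x, g i x ∂μ) ^ q ≤ (∫⁻ x, (∑' i, g i x ^ q) ^ (1 / q) ∂μ) ^ q := by
  have hq0 : 0 < q := by linarith
  have hq1 : 1 / q ≤ 1 := by rw [div_le_one hq0]; exact hq
  set N := ∫⁻ x, (∑' i, g i x ^ q) ^ (1 / q) ∂μ with hN
  rcases eq_or_ne N ∞ with htop | hfin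
  · rw [htop, ENNReal.top_rpow_of_pos hq0]; exact le_top
  have hle : ∀ i, ∫⁻ x, g i x ∂μ ≤ N := fun i => lintegral_mono fun x => by
    rw [one_div, ENNReal.le_rpow_inv_iff hq0]
    exact ENNReal.le_tsum i
  have hifin : ∀ i, ∫⁻ x, g i x ∂μ ≠ ∞ := fun i => ne_top_of_le_ne_top hfin (hle i)
  rw [ENNReal.tsum_eq_iSup_sum]
  refine iSup_le fun A => ?_
  set a : ι → ℝ≥0∞ := fun i => ∫⁻ x, g i x ∂μ
  set S := ∑ i ∈ A, a i ^ q with hS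
  have hSfin : S ≠ ∞ := (ENNReal.sum_lt_top.2 fun i _ =>
    ENNReal.rpow_lt_top_of_nonneg hq0.le (hifin i)).ne
  rcases eq_or_ne S 0 with hS0 | hS0
  · rw [hS0]; exact zero_le
  have hexp : q * (1 - 1 / q) = q - 1 := by field_simp
  -- Duality: one factor of a^q is expanded as an integral, Hölder is applied pointwise in `x`, and
  -- `S ^ (1 - 1 / q)` is then cancelled, `S` being finite because `A` is.
  have hkey : S ≤ S ^ (1 - 1 / q) * N := by
    calc S = ∑ i ∈ A, a i ^ (q - 1) * a i := by
          refine Finset.sum_congr rfl fun i _ => ?_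
          have := ENNReal.rpow_add_of_nonneg (x := a i) (q - 1) 1 (by linarith) zero_le_one
          rwa [sub_add_cancel, ENNReal.rpow_one] at this
      _ = ∫⁻ x, ∑ i ∈ A, a i ^ (q - 1) * g i x ∂μ := by
          rw [lintegral_finsetSum' A fun i _ => (hg i).const_mul _]
          refine Finset.sum_congr rfl fun i _ => ?_
          rw [lintegral_const_mul' _ _
            (ENNReal.rpow_ne_top_of_nonneg (by linarith) (hifin i))]
      _ ≤ ∫⁻ x, S ^ (1 - 1 / q) * (∑' i, g i x ^ q) ^ (1 / q) ∂μ := by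
          refine lintegral_mono fun x => ?_
          have h := tsum_mul_rpow_le (fun i : A => a i ^ q) (fun i : A => g i x ^ q)
            (s := 1 - 1 / q) (t := 1 / q) (by linarith) (by positivity) (by ring)
          simp only [← ENNReal.rpow_mul, hexp, mul_one_div_cancel hq0.ne', ENNReal.rpow_one] at h
          rw [Finset.tsum_subtype A (fun i => a i ^ (q - 1) * g i x),
            Finset.tsum_subtype A (fun i => a i ^ q),
            Finset.tsum_subtype A (fun i => g i x ^ q)] at h
          refine h.trans ?_
          gcongr
          exact ENNReal.sum_le_tsum A
      _ = S ^ (1 - 1 / q) * N :=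
          lintegral_const_mul' _ _ (ENNReal.rpow_ne_top_of_nonneg (by linarith) hSfin)
  have hsplit : S = S ^ (1 - 1 / q) * S ^ (1 / q) := by
    rw [← ENNReal.rpow_add _ _ hS0 hSfin, sub_add_cancel, ENNReal.rpow_one]
  have hne : S ^ (1 - 1 / q) ≠ 0 := by simp [ENNReal.rpow_eq_zero_iff, hS0, hSfin]
  have hne' : S ^ (1 - 1 / q) ≠ ∞ := ENNReal.rpow_ne_top_of_nonneg (by linarith) hSfin
  rw [← ENNReal.rpow_inv_le_iff hq0, ← one_div, ← ENNReal.mul_le_mul_iff_right hne hne', ← hsplit]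
  exact hkey

/-! ### Fibers, the periodic part and the estimate. -/

section Fibers

variable {d : ℕ} {p : ℝ}

/-- The restriction of a function to the lattice translates of `x`. -/
def fiber (f : EuclideanSpace ℝ (Fin d) → ℝ) (x : EuclideanSpace ℝ (Fin d)) (k : Fin d → ℤ) : ℝ :=
  f (x + latticeVector k)

/-- The limit of a function at infinity along the lattice translates of a point. -/
def latticeLimit (f : EuclideanSpace ℝ (Fin d) → ℝ) (x : EuclideanSpace ℝ (Fin d)) : ℝ :=
  Filter.limUnder Filter.cofinite (fiber f x)

lemma fiber_add_latticeVector (f : EuclideanSpace ℝ (Fin d) → ℝ) (x : EuclideanSpace ℝ (Fin d))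
    (m : Fin d → ℤ) : fiber f (x + latticeVector m) = fiber f x ∘ Equiv.addLeft m := by
  ext k
  simp [fiber, latticeVector_add, add_assoc]

/-- Lattice translations preserve the cofinite filter, and `limUnder` depends only on the image
filter. Periodicity therefore holds at every point, even where the fiber has no limit. -/
lemma isPeriodic_latticeLimit (f : EuclideanSpace ℝ (Fin d) → ℝ) :
    IsPeriodic (latticeLimit f) := by
  intro m x
  have h : Filter.map (Equiv.addLeft m) Filter.cofinite =
      (Filter.cofinite : Filter (Fin d → ℤ)) :=
    le_antisymm (Equiv.addLeft m).injective.tendsto_cofinite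
      (Equiv.addLeft m).surjective.le_map_cofinite
  rw [latticeLimit, latticeLimit, fiber_add_latticeVector, Filter.limUnder, Filter.limUnder, ← Filter.map_map, h]

lemma latticeDiff_fiber (f : EuclideanSpace ℝ (Fin d) → ℝ) (x : EuclideanSpace ℝ (Fin d))
    (i : Fin d) (k : Fin d → ℤ) :
    latticeDiff (fiber f x) i k = discreteGradient f (x + latticeVector k) i := by
  simp [latticeDiff, fiber, discreteGradient, latticeVector_add, latticeVector_single, add_assoc]

lemma sobolevExponent_gt_one (hp : 1 ≤ p) (hpd : p < d) : 1 < sobolevExponent d p := by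
  have : 0 < (d : ℝ) - p := by linarith
  rw [sobolevExponent, lt_div_iff₀ this]
  nlinarith

/-- Needed for the cofinite filter to be nontrivial, hence for limits along it to be unique. -/
lemma infinite_lattice (hp : 1 ≤ p) (hpd : p < d) : Infinite (Fin d → ℤ) := by
  have : 0 < d := by exact_mod_cast (by linarith : (0 : ℝ) < d)
  have : Nonempty (Fin d) := ⟨⟨0, this⟩⟩
  infer_instance

lemma tendsto_cofinite_of_tsum_ne_top {ι : Type*} {u : ι → ℝ} {c q : ℝ} (hq : 0 < q)
    (h : ∑' k, ‖u k - c‖ₑ ^ q ≠ ∞) : Filter.Tendsto u Filter.cofinite (nhds c) := by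
  have h1 := (ENNReal.continuous_rpow_const (y := 1 / q)).tendsto 0 |>.comp
    (ENNReal.tendsto_cofinite_zero_of_tsum_ne_top h)
  rw [tendsto_iff_edist_tendsto_0]
  rw [ENNReal.zero_rpow_of_pos (by positivity)] at h1
  refine h1.congr fun k => ?_
  rw [Function.comp_apply, ← ENNReal.rpow_mul, mul_one_div_cancel hq.ne', ENNReal.rpow_one,
    edist_eq_enorm_sub]

/-- The discrete Gagliardo–Nirenberg–Sobolev inequality on `ℤ^d`: functions of finite energy
converge at infinity, and the inequality holds after subtraction of the limit. -/
lemma exists_tendsto_and_tsum_sub_limUnder_le (hp : 1 ≤ p) (hpd : p < d) :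
    ∃ C : ℝ≥0, ∀ u : (Fin d → ℤ) → ℝ, latticeEnergy p u ≠ ∞ →
      Filter.Tendsto u Filter.cofinite (nhds (Filter.limUnder Filter.cofinite u)) ∧
      (∑' k, ‖u k - Filter.limUnder Filter.cofinite u‖ₑ ^ sobolevExponent d p) ^
        (1 / sobolevExponent d p) ≤ C * latticeEnergy p u ^ (1 / p) := by
  obtain ⟨C, hC⟩ := exists_tsum_sub_rpow_le_latticeEnergy hp hpd
  refine ⟨C, fun u hu => ?_⟩
  have hq0 : 0 < sobolevExponent d p := by linarith [sobolevExponent_gt_one hp hpd]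
  have := infinite_lattice hp hpd
  obtain ⟨c, hc⟩ := hC u hu
  have hfin : ∑' k, ‖u k - c‖ₑ ^ sobolevExponent d p ≠ ∞ := by
    intro htop
    rw [htop, ENNReal.top_rpow_of_pos (by positivity), top_le_iff] at hc
    exact ENNReal.mul_ne_top ENNReal.coe_ne_top
      (ENNReal.rpow_ne_top_of_nonneg (by positivity) hu) hc
  have ht := tendsto_cofinite_of_tsum_ne_top hq0 hfin
  rw [ht.limUnder_eq]
  exact ⟨ht, hc⟩

/-- Unfolding gives the integral over ℝ^d of the sum of the |δ_i f|^p; each of the `d` coordinates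
is bounded by the Euclidean length. -/
lemma setLIntegral_latticeEnergy_fiber_le (hp : 1 ≤ p) {f : EuclideanSpace ℝ (Fin d) → ℝ}
    (hf : MemDiscreteSobolev p f) (z : EuclideanSpace ℝ (Fin d)) :
    ∫⁻ x in unitCube z, latticeEnergy p (fiber f x) ≤
      d * eLpNorm (discreteGradient f) (ENNReal.ofReal p) volume ^ p := by
  have hp0 : 0 < p := by linarith
  have hcoord : ∀ i, AEMeasurable (fun x => ‖discreteGradient f x i‖ₑ ^ p) volume := fun i =>
    ((by fun_prop : Continuous fun v : EuclideanSpace ℝ (Fin d) => v i).comp_aestronglyMeasurable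
      hf.memLp_discreteGradient.1).enorm.pow_const p
  have hmeas : AEMeasurable (fun x => ∑ i, ‖discreteGradient f x i‖ₑ ^ p) volume :=
    Finset.aemeasurable_fun_sum _ fun i _ => hcoord i
  have h := lintegral_eq_setLIntegral_unitCube_tsum z hmeas
  simp only [latticeEnergy, latticeDiff_fiber]
  rw [← h, eLpNorm_eq_lintegral_rpow_enorm_toReal (by simpa using hp0) ENNReal.ofReal_ne_top,
    ENNReal.toReal_ofReal hp0.le, ← ENNReal.rpow_mul, one_div_mul_cancel hp0.ne',
    ENNReal.rpow_one, ← lintegral_const_mul' _ _ (by simp)]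
  refine lintegral_mono fun x => ?_
  refine (Finset.sum_le_sum (g := fun _ => ‖discreteGradient f x‖ₑ ^ p) fun i _ => ?_).trans_eq
    (by simp)
  refine ENNReal.rpow_le_rpow ?_ hp0.le
  exact enorm_le_iff_norm_le.2 (PiLp.norm_apply_le _ i)

lemma eLpNorm_discreteGradient_ne_top {f : EuclideanSpace ℝ (Fin d) → ℝ}
    (hf : MemDiscreteSobolev p f) :
    eLpNorm (discreteGradient f) (ENNReal.ofReal p) volume ≠ ∞ :=
  hf.memLp_discreteGradient.2.ne

lemma aestronglyMeasurable_fiber {f : EuclideanSpace ℝ (Fin d) → ℝ}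
    (hf : AEStronglyMeasurable f volume) (k : Fin d → ℤ) :
    AEStronglyMeasurable (fun x => fiber f x k) volume :=
  hf.comp_quasiMeasurePreserving (quasiMeasurePreserving_add_const _)

lemma aemeasurable_latticeEnergy_fiber {f : EuclideanSpace ℝ (Fin d) → ℝ}
    (hf : AEStronglyMeasurable f volume) :
    AEMeasurable (fun x => latticeEnergy p (fiber f x)) volume := by
  refine AEMeasurable.tsum fun k => Finset.aemeasurable_fun_sum _ fun i _ => ?_
  exact ((aestronglyMeasurable_fiber hf _).sub (aestronglyMeasurable_fiber hf _)).enorm.pow_const p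

lemma ae_latticeEnergy_fiber_ne_top (hp : 1 ≤ p) {f : EuclideanSpace ℝ (Fin d) → ℝ}
    (hf : MemDiscreteSobolev p f) : ∀ᵐ x, latticeEnergy p (fiber f x) ≠ ∞ := by
  refine ae_of_ae_restrict_unitCube fun z => ?_
  have h := (setLIntegral_latticeEnergy_fiber_le hp hf z).trans_lt
    (ENNReal.mul_ne_top (ENNReal.natCast_ne_top d)
      (ENNReal.rpow_ne_top_of_nonneg (by linarith)
        (eLpNorm_discreteGradient_ne_top hf))).lt_top
  have hm := (aemeasurable_latticeEnergy_fiber (p := p)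
    hf.locallyIntegrable.aestronglyMeasurable).restrict (s := unitCube z)
  filter_upwards [ae_lt_top' hm h.ne] with x hx using hx.ne

/-- Along the diagonal points (n, …, n) the limit becomes that of a sequence of measurable
functions. -/
lemma aestronglyMeasurable_latticeLimit (hp : 1 ≤ p) (hpd : p < d)
    {f : EuclideanSpace ℝ (Fin d) → ℝ} (hf : MemDiscreteSobolev p f) :
    AEStronglyMeasurable (latticeLimit f) volume := by
  obtain ⟨C, hC⟩ := exists_tendsto_and_tsum_sub_limUnder_le hp hpd
  have hd : 0 < d := by exact_mod_cast (by linarith : (0 : ℝ) < d)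
  have hinj : Function.Injective fun (n : ℕ) (_ : Fin d) => (n : ℤ) := fun a b h =>
    Int.ofNat_injective (congrFun h ⟨0, hd⟩)
  refine aestronglyMeasurable_of_tendsto_ae Filter.atTop
    (f := fun (n : ℕ) x => fiber f x fun _ => (n : ℤ))
    (fun n => aestronglyMeasurable_fiber hf.locallyIntegrable.aestronglyMeasurable _) ?_
  filter_upwards [ae_latticeEnergy_fiber_ne_top hp hf] with x hx
  have ht := hinj.tendsto_cofinite
  rw [Nat.cofinite_eq_atTop] at ht
  exact (hC _ hx).1.comp ht

/-- The mixed `L^1(ℓ^{p^*})` bound for the distance to the lattice limit. -/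
lemma exists_setLIntegral_fiber_sub_latticeLimit_le (hp : 1 ≤ p) (hpd : p < d) :
    ∃ C : ℝ≥0, ∀ f : EuclideanSpace ℝ (Fin d) → ℝ, MemDiscreteSobolev p f →
      ∀ z : EuclideanSpace ℝ (Fin d),
      ∫⁻ x in unitCube z, (∑' k, ‖fiber (fun y => f y - latticeLimit f y) x k‖ₑ ^
        sobolevExponent d p) ^ (1 / sobolevExponent d p) ≤
      C * eLpNorm (discreteGradient f) (ENNReal.ofReal p) volume := by
  obtain ⟨C, hC⟩ := exists_tendsto_and_tsum_sub_limUnder_le hp hpd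
  have hp0 : 0 < p := by linarith
  have hp1 : 1 / p ≤ 1 := by rw [div_le_one hp0]; exact hp
  refine ⟨C * (d : ℝ≥0) ^ (1 / p), fun f hf z => ?_⟩
  have hK := (aemeasurable_latticeEnergy_fiber (p := p)
    hf.locallyIntegrable.aestronglyMeasurable).restrict (s := unitCube z)
  -- Hölder against the constant 1 on a cube of volume 1, passing from L^p to L^1 at no cost.
  have hhold := ENNReal.lintegral_mul_norm_pow_le hK (aemeasurable_const (b := (1 : ℝ≥0∞)))
    (p := 1 / p) (q := 1 - 1 / p) (by positivity) (by linarith) (by ring)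
  simp only [ENNReal.one_rpow, mul_one, lintegral_one, Measure.restrict_apply_univ,
    volume_unitCube] at hhold
  calc _ ≤ ∫⁻ x in unitCube z, C * latticeEnergy p (fiber f x) ^ (1 / p) := by
        refine lintegral_mono_ae (ae_restrict_of_ae ?_)
        filter_upwards [ae_latticeEnergy_fiber_ne_top hp hf] with x hx
        refine le_trans (le_of_eq ?_) (hC _ hx).2
        congr 1
        refine tsum_congr fun k => ?_
        simp only [fiber, isPeriodic_latticeLimit f k x]
        rfl
    _ = C * ∫⁻ x in unitCube z, latticeEnergy p (fiber f x) ^ (1 / p) :=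
        lintegral_const_mul' _ _ ENNReal.coe_ne_top
    _ ≤ C * (d * eLpNorm (discreteGradient f) (ENNReal.ofReal p) volume ^ p) ^ (1 / p) := by
        gcongr
        refine hhold.trans ?_
        gcongr
        exact setLIntegral_latticeEnergy_fiber_le hp hf z
    _ = _ := by
        rw [ENNReal.mul_rpow_of_nonneg _ _ (by positivity), ← ENNReal.rpow_mul,
          mul_one_div_cancel hp0.ne', ENNReal.rpow_one, ENNReal.coe_mul,
          ENNReal.coe_rpow_of_nonneg _ (by positivity), ENNReal.coe_natCast, mul_assoc]

/-- A bound in `L^1(ℓ^{p^*})` on every unit cube gives a bound in `E^p`. -/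
lemma memE_and_normE_le_of_setLIntegral_fiber_le (hq : 1 < sobolevExponent d p)
    {g : EuclideanSpace ℝ (Fin d) → ℝ} (hg : AEStronglyMeasurable g volume) {N : ℝ≥0∞}
    (hN : N ≠ ∞)
    (h : ∀ z : EuclideanSpace ℝ (Fin d), ∫⁻ x in unitCube z,
      (∑' k, ‖fiber g x k‖ₑ ^ sobolevExponent d p) ^ (1 / sobolevExponent d p) ≤ N) :
    MemE p g ∧ normE p g ≤ N := by
  set q := sobolevExponent d p with hqdef
  have hq0 : 0 < q := by linarith
  have hint : ∀ z, IntegrableOn g (unitCube z) volume := by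
    intro z
    refine ⟨hg.restrict, ?_⟩
    refine lt_of_le_of_lt (lintegral_mono fun x => ?_) ((h z).trans_lt hN.lt_top)
    rw [one_div, ENNReal.le_rpow_inv_iff hq0]
    have h0 : fiber g x 0 = g x := by
      have : latticeVector (0 : Fin d → ℤ) = 0 := by ext i; simp
      simp [fiber, this]
    have := ENNReal.le_tsum (f := fun k => ‖fiber g x k‖ₑ ^ q) 0
    simpa only [h0] using this
  have hmeas : AEStronglyMeasurable (localAverage fun x => |g x|) volume :=
    aestronglyMeasurable_localAverage hg.norm
  have hnorm : normE p g ≤ N := by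
    rw [normE, ← hqdef, eLpNorm_eq_lintegral_rpow_enorm_toReal (by simpa using hq0)
      ENNReal.ofReal_ne_top, ENNReal.toReal_ofReal hq0.le, one_div, ENNReal.rpow_inv_le_iff hq0,
      lintegral_eq_setLIntegral_unitCube_tsum 0 (hmeas.enorm.pow_const q)]
    calc _ ≤ ∫⁻ _x in unitCube (0 : EuclideanSpace ℝ (Fin d)), N ^ q := by
          refine lintegral_mono fun z => ?_
          -- The average at `z + k` is the integral over the cube at `z` of the translate by `k`, so
          -- Minkowski applies to the fiber norms.
          simp only [enorm_localAverage_abs (hint _), setLIntegral_unitCube_add]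
          refine (tsum_lintegral_rpow_le hq.le fun k =>
            ((aestronglyMeasurable_fiber hg k).restrict (s := unitCube z)).enorm).trans ?_
          exact ENNReal.rpow_le_rpow (h z) hq0.le
      _ = N ^ q := by simp [volume_unitCube]
  exact ⟨⟨locallyIntegrable_of_unitCube hint, hmeas, hnorm.trans_lt hN.lt_top⟩, hnorm⟩

/-! ### Uniqueness of the periodic part. -/

/-- Two almost everywhere periodic functions at finite `E^p` distance from the same function agree
almost everywhere. -/
lemma ae_eq_of_memE_sub (hp : 1 ≤ p) (hpd : p < d) {f g₁ g₂ : EuclideanSpace ℝ (Fin d) → ℝ}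
    (hg₁ : IsAEPeriodic g₁) (hg₂ : IsAEPeriodic g₂) (h₁ : MemE p fun x => f x - g₁ x)
    (h₂ : MemE p fun x => f x - g₂ x) : g₁ =ᵐ[volume] g₂ := by
  have hq1 := sobolevExponent_gt_one hp hpd
  set q := sobolevExponent d p with hq
  have hq0 : 0 < q := by linarith
  set h : EuclideanSpace ℝ (Fin d) → ℝ := fun x => g₂ x - g₁ x with hh
  have heq : h = fun x => (f x - g₁ x) - (f x - g₂ x) := by ext x; simp [hh]
  have hloc : LocallyIntegrable h volume := by
    rw [heq]; exact h₁.locallyIntegrable.sub h₂.locallyIntegrable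
  have hmeas : AEMeasurable (fun x => ‖h x‖ₑ) volume := hloc.aestronglyMeasurable.enorm
  set m := ∫⁻ x in unitCube (0 : EuclideanSpace ℝ (Fin d)), ‖h x‖ₑ with hm
  have hconst : ∀ z, ∫⁻ x in unitCube z, ‖h x‖ₑ = m := fun z =>
    setLIntegral_unitCube_eq_of_periodic hmeas (fun k => by
      filter_upwards [hg₁ k, hg₂ k] with x hx₁ hx₂
      simp only [hh, hx₁, hx₂]) z 0
  have hle : ∀ z, m ≤ ‖localAverage (fun x => |f x - g₁ x|) z‖ₑ +
      ‖localAverage (fun x => |f x - g₂ x|) z‖ₑ := by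
    intro z
    rw [enorm_localAverage_abs (integrableOn_unitCube h₁.locallyIntegrable z),
      enorm_localAverage_abs (integrableOn_unitCube h₂.locallyIntegrable z), ← hconst z, heq,
      ← lintegral_add_left' h₁.locallyIntegrable.aestronglyMeasurable.enorm.restrict]
    exact lintegral_mono fun x => enorm_sub_le
  have hLq : ∀ {a : EuclideanSpace ℝ (Fin d) → ℝ}, MemLp a (ENNReal.ofReal q) volume →
      ∫⁻ z, ‖a z‖ₑ ^ q < ∞ := fun ha => by
    have := lintegral_rpow_enorm_lt_top_of_eLpNorm_lt_top (by simpa using hq0)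
      ENNReal.ofReal_ne_top ha.2
    rwa [ENNReal.toReal_ofReal hq0.le] at this
  have hfin := ENNReal.lintegral_rpow_add_lt_top_of_lintegral_rpow_lt_top
    h₁.memLp_localAverage.1.enorm (hLq h₁.memLp_localAverage) (hLq h₂.memLp_localAverage) hq1.le
  have hm0 : m = 0 := by
    by_contra hm0
    have : Nonempty (Fin d) := ⟨⟨0, by exact_mod_cast (by linarith : (0 : ℝ) < d)⟩⟩
    have hvol : volume (Set.univ : Set (EuclideanSpace ℝ (Fin d))) = ∞ := by
      have := NormedSpace.noncompactSpace ℝ (EuclideanSpace ℝ (Fin d))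
      exact measure_univ_of_isAddLeftInvariant _
    -- A positive constant would have a finite integral over a space of infinite measure.
    have hlow : ∫⁻ _z : EuclideanSpace ℝ (Fin d), m ^ q < ∞ :=
      lt_of_le_of_lt (lintegral_mono fun z => ENNReal.rpow_le_rpow (hle z) hq0.le) hfin
    rw [lintegral_const, hvol, ENNReal.mul_top (by simp [ENNReal.rpow_eq_zero_iff, hm0, hq0.not_gt])] at hlow
    exact lt_irrefl _ hlow
  have hae : ∀ᵐ x, h x = 0 := ae_of_ae_restrict_unitCube fun z => by
    have h0 := (lintegral_eq_zero_iff' hmeas.restrict).1 ((hconst z).trans hm0)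
    filter_upwards [h0] with x hx using by simpa using hx
  filter_upwards [hae] with x hx
  exact (sub_eq_zero.1 hx).symm

end Fibers

end DiscreteGNS

end

theorem proposition1p1 (d : ℕ) (p : ℝ) (hp : 1 ≤ p) (hpd : p < d) :
    ∃ C : ℝ≥0, 0 < C ∧
      ∀ f : EuclideanSpace ℝ (Fin d) → ℝ, DiscreteGNS.MemDiscreteSobolev p f →
        ∃ fper : EuclideanSpace ℝ (Fin d) → ℝ,
          DiscreteGNS.IsPeriodic fper ∧
          DiscreteGNS.MemE p (fun x => f x - fper x) ∧
          (∀ g : EuclideanSpace ℝ (Fin d) → ℝ, DiscreteGNS.IsAEPeriodic g →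
            DiscreteGNS.MemE p (fun x => f x - g x) → g =ᵐ[volume] fper) ∧
          DiscreteGNS.normE p (fun x => f x - fper x) ≤
            C * eLpNorm (DiscreteGNS.discreteGradient f) (ENNReal.ofReal p) volume := by
  obtain ⟨C, hC⟩ := DiscreteGNS.exists_setLIntegral_fiber_sub_latticeLimit_le hp hpd
  -- The added 1 only secures positivity of the constant.
  refine ⟨C + 1, by positivity, fun f hf => ?_⟩
  have hper := DiscreteGNS.isPeriodic_latticeLimit f
  obtain ⟨hE, hle⟩ := DiscreteGNS.memE_and_normE_le_of_setLIntegral_fiber_le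
    (DiscreteGNS.sobolevExponent_gt_one hp hpd)
    (hf.locallyIntegrable.aestronglyMeasurable.sub
      (DiscreteGNS.aestronglyMeasurable_latticeLimit hp hpd hf))
    (ENNReal.mul_ne_top ENNReal.coe_ne_top (DiscreteGNS.eLpNorm_discreteGradient_ne_top hf))
    (hC f hf)
  refine ⟨DiscreteGNS.latticeLimit f, hper, hE, fun g hg hgE => ?_, hle.trans ?_⟩
  · exact DiscreteGNS.ae_eq_of_memE_sub hp hpd hg
      (fun k => Filter.Eventually.of_forall (hper k)) hgE hE
  · gcongr
    exact le_self_add
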